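/- Let $a<b$, $n\ge 1$, $d\ge 2$, $1<q<\infty$, let $C\subsetneq\mathbb R^d$ be a nonempty closed convex cone with dual cone $C^+=\{\zeta\in\mathbb R^d \mid \zeta\cdot z\ge 0 \text{ for all } z\in C\}$, and let $A,B\in\mathbb R^n$. Let $L:[a,b]\times\mathbb R^n\times\mathbb R^n\to\mathbb R^d$, $(t,y,p)\mapsto L(t,y,p)$, be of class $C^1$ and suppose that there are constants $K_1,K_2$ such that for every component $L_i$ and all $t\in[a,b]$, $y,p\in\mathbb R^n$ $$|L_i(t,y,p)|\le K_1(|y|^q+|p|^q+1),$$ $$|D_pL_i(t,y,p)|\le K_2(|y|^{q-1}+|p|^{q-1}+1),\qquad |D_yL_i(t,y,p)|\le K_2(|y|^{q-1}+|p|^{q-1}+1).$$ Let $\mathcal X_1=\{y\in W^{1,q}([a,b];\mathbb R^n)\mid y(a)=A,\ y(b)=B\}$, where endpoint values are those of the continuous representative, and let $W^{1,q}_0([a,b];\mathbb R^n)$ be the subspace of the elements of $W^{1,q}([a,b];\mathbb R^n)$ vanishing at $a$ and $b$, with the norm of $W^{1,q}$. For $y\in\mathcal X_1$ put $$J(y)=\int_a^b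 L(t,y(t),\dot y(t))\,dt,\qquad \overline J(y)=\int_a^b \big(L(t,y(t),\dot y(t))+C\big)\,dt=J(y)+C$$ (the second integral being an Aumann integral), and for a family $\mathcal A$ of subsets of $\mathbb R^d$ put $\inf\mathcal A=\mathrm{cl\,co}\bigcup_{S\in\mathcal A}S$. Let $M\subseteq\mathcal X_1$ be an infimizer for $\overline J$, i.e. $\inf\{\overline J(y)\mid y\in M\}=\inf\{\overline J(y)\mid y\in\mathcal X_1\}$. Let $\zeta\in C^+\setminus\{0\}$ and suppose that $M$ contains a $\zeta$-solution $y_\zeta$, i.e. $\zeta\cdot J(y_\zeta)=\inf\{\zeta\cdot z\mid z\in\overline J(y),\ y\in\mathcal X_1\}$. Define $\varphi_{\zeta,M}:W^{1,q}_0([a,b];\mathbb R^n)\to[-\infty,+\infty]$ by $$\varphi_{\zeta,M}(v)=\inf\{\zeta\cdot z\mid z\in\widehat J(v;M)\},\qquad \widehat J(v;M)=\inf\{\overline J(y+v)\mid y\in M\},$$ and put $L_\zeta=\zeta\cdot L$. Then $\varphi_{\zeta,M}$ is finite near $0$ and Fréchet differentiable at $0$, and for all $v\in W^{1,q}_0([a,b];\mathbb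 R^n)$ $$\varphi_{\zeta,M}'(0)(v)=\int_a^b\left[D_yL_\zeta(t,y_\zeta,\dot y_\zeta)\cdot v+D_pL_\zeta(t,y_\zeta,\dot y_\zeta)\cdot\dot v\right]dt,$$ the integrand being integrable. Moreover $y_\zeta$ is a weak solution of the Euler–Lagrange equation $\frac{d}{dt}D_pL_\zeta(t,y,\dot y)=D_yL_\zeta(t,y,\dot y)$, that is, $y_\zeta\in\mathcal X_1$ and the integral above vanishes for every $v\in W^{1,q}_0([a,b];\mathbb R^n)$. -/

import Mathlib

open MeasureTheory Set Filter Topology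
open scoped ENNReal Pointwise

namespace SetCalcVar

/-- The Euclidean space `ℝᵏ`. -/
abbrev E (k : ℕ) := EuclideanSpace ℝ (Fin k)

/-- Lebesgue measure on `[a, b]`. -/
noncomputable abbrev μI (a b : ℝ) : Measure ℝ := volume.restrict (Icc a b)

/-! ### Sobolev spaces on an interval -/

/-- `g` is the weak derivative of `y` on the open interval `(a, b)`, tested against
`φ ∈ C_c^∞((a, b))`. -/
def HasWeakDeriv {k : ℕ} (a b : ℝ) (y g : ℝ → E k) : Prop :=
  ∀ φ : ℝ → ℝ, ContDiff ℝ (⊤ : ℕ∞) φ → HasCompactSupport φ → tsupport φ ⊆ Ioo a b →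
    ∫ t in Icc a b, deriv φ t • y t = - ∫ t in Icc a b, φ t • g t

/-- A continuous compactly supported real function times an `L^q` function is integrable. -/
theorem integrable_smul_Lp {k : ℕ} {a b : ℝ} {q : ℝ≥0∞} [hq : Fact (1 ≤ q)]
    {φ : ℝ → ℝ} (hφ : Continuous φ) (hc : HasCompactSupport φ) (u : Lp (E k) q (μI a b)) :
    Integrable (fun t => φ t • u t) (μI a b) := by
  have hu : Integrable (fun t => u t) (μI a b) := (Lp.memLp u).integrable hq.out
  obtain ⟨c, hcb⟩ := hφ.bounded_above_of_compact_support hc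
  exact hu.bdd_smul c hφ.aestronglyMeasurable (ae_of_all _ hcb)

/-- The Sobolev space `W^{1,q}([a,b]; ℝᵏ)`: pairs `(y, ẏ)` in `L^q × L^q` with `ẏ` the weak
derivative of `y`, normed by `(‖y‖_q ^ q + ‖ẏ‖_q ^ q) ^ (1/q)`. -/
noncomputable def W1q (a b : ℝ) (k : ℕ) (q : ℝ≥0∞) [Fact (1 ≤ q)] :
    Submodule ℝ (WithLp q (Lp (E k) q (μI a b) × Lp (E k) q (μI a b))) where
  carrier := {u | HasWeakDeriv a b u.fst u.snd}
  zero_mem' := by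
    intro φ _ _ _
    have h0 := Lp.coeFn_zero (E k) q (μI a b)
    have h1 : ∫ t in Icc a b, deriv φ t • (0 : Lp (E k) q (μI a b)) t = 0 := by
      rw [← integral_zero (α := ℝ) (G := E k) (μ := μI a b)]
      refine integral_congr_ae ?_
      filter_upwards [h0] with t ht
      simp only [ht, Pi.zero_apply, smul_zero]
    have h2 : ∫ t in Icc a b, φ t • (0 : Lp (E k) q (μI a b)) t = 0 := by
      rw [← integral_zero (α := ℝ) (G := E k) (μ := μI a b)]
      refine integral_congr_ae ?_
      filter_upwards [h0] with t ht
      simp only [ht, Pi.zero_apply, smul_zero]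
    change ∫ t in Icc a b, deriv φ t • (0 : Lp (E k) q (μI a b)) t
      = - ∫ t in Icc a b, φ t • (0 : Lp (E k) q (μI a b)) t
    rw [h1, h2, neg_zero]
  add_mem' := by
    intro u v hu hv φ hφ hc hs
    have hd : Continuous (deriv φ) := hφ.continuous_deriv (by simp)
    have e1 : ∫ t in Icc a b, deriv φ t • (u.fst + v.fst) t
        = (∫ t in Icc a b, deriv φ t • u.fst t) + ∫ t in Icc a b, deriv φ t • v.fst t := by
      rw [← integral_add (integrable_smul_Lp hd hc.deriv _) (integrable_smul_Lp hd hc.deriv _)]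
      refine integral_congr_ae ?_
      filter_upwards [Lp.coeFn_add u.fst v.fst] with t ht
      simp only [ht, Pi.add_apply, smul_add]
    have e2 : ∫ t in Icc a b, φ t • (u.snd + v.snd) t
        = (∫ t in Icc a b, φ t • u.snd t) + ∫ t in Icc a b, φ t • v.snd t := by
      rw [← integral_add (integrable_smul_Lp hφ.continuous hc _)
        (integrable_smul_Lp hφ.continuous hc _)]
      refine integral_congr_ae ?_
      filter_upwards [Lp.coeFn_add u.snd v.snd] with t ht
      simp only [ht, Pi.add_apply, smul_add]
    change ∫ t in Icc a b, deriv φ t • (u.fst + v.fst) t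
      = - ∫ t in Icc a b, φ t • (u.snd + v.snd) t
    rw [e1, e2, hu φ hφ hc hs, hv φ hφ hc hs, neg_add]
  smul_mem' := by
    intro c u hu φ hφ hc hs
    have e1 : ∫ t in Icc a b, deriv φ t • (c • u.fst) t
        = c • ∫ t in Icc a b, deriv φ t • u.fst t := by
      rw [← integral_smul]
      refine integral_congr_ae ?_
      filter_upwards [Lp.coeFn_smul c u.fst] with t ht
      simp only [ht, Pi.smul_apply, smul_comm c]
    have e2 : ∫ t in Icc a b, φ t • (c • u.snd) t = c • ∫ t in Icc a b, φ t • u.snd t := by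
      rw [← integral_smul]
      refine integral_congr_ae ?_
      filter_upwards [Lp.coeFn_smul c u.snd] with t ht
      simp only [ht, Pi.smul_apply, smul_comm c]
    change ∫ t in Icc a b, deriv φ t • (c • u.fst) t = - ∫ t in Icc a b, φ t • (c • u.snd) t
    rw [e1, e2, hu φ hφ hc hs, smul_neg]

/-- `W^{1,q}` is normed as a subspace of `L^q × L^q`. -/
noncomputable instance instNormedW1q (a b : ℝ) (k : ℕ) (q : ℝ≥0∞) [Fact (1 ≤ q)] :
    NormedAddCommGroup (W1q a b k q) := Submodule.normedAddCommGroup (W1q a b k q)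

noncomputable instance instNormedSpaceW1q (a b : ℝ) (k : ℕ) (q : ℝ≥0∞) [Fact (1 ≤ q)] :
    NormedSpace ℝ (W1q a b k q) := Submodule.normedSpace (W1q a b k q)

section Sobolev

variable {a b : ℝ} {k : ℕ} {q : ℝ≥0∞} [Fact (1 ≤ q)]

/-- The (a.e. defined) function underlying an element of `W^{1,q}`. -/
noncomputable def fn (u : W1q a b k q) : ℝ → E k := u.1.fst

/-- The weak derivative of an element of `W^{1,q}`. -/
noncomputable def dot (u : W1q a b k q) : ℝ → E k := u.1.snd

/-- `y(a) = A` and `y(b) = B`, in the sense of the continuous representative of `y`. -/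
def HasEndpoints (u : W1q a b k q) (A B : E k) : Prop :=
  ∃ y : ℝ → E k, ContinuousOn y (Icc a b) ∧ fn u =ᵐ[μI a b] y ∧ y a = A ∧ y b = B

end Sobolev

/-- The space `W_0^{1,q}([a,b]; ℝᵏ)` of elements of `W^{1,q}` vanishing at both endpoints, with
the norm of `W^{1,q}`. -/
noncomputable def W1q0 (a b : ℝ) (k : ℕ) (q : ℝ≥0∞) [Fact (1 ≤ q)] :
    Submodule ℝ (W1q a b k q) where
  carrier := {u | HasEndpoints u 0 0}
  zero_mem' := ⟨0, continuousOn_const, Lp.coeFn_zero (E k) q (μI a b), rfl, rfl⟩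
  add_mem' := by
    rintro u v ⟨y, hy, hu, ya, yb⟩ ⟨z, hz, hv, za, zb⟩
    refine ⟨y + z, hy.add hz, ?_, by simp [ya, za], by simp [yb, zb]⟩
    exact (Lp.coeFn_add u.1.fst v.1.fst).trans (hu.add hv)
  smul_mem' := by
    rintro c u ⟨y, hy, hu, ya, yb⟩
    refine ⟨c • y, hy.const_smul c, ?_, by simp [ya], by simp [yb]⟩
    exact (Lp.coeFn_smul c u.1.fst).trans (hu.const_smul c)

/-- `W_0^{1,q}` is normed as a subspace of `W^{1,q}`. -/
noncomputable instance instNormedW1q0 (a b : ℝ) (k : ℕ) (q : ℝ≥0∞) [Fact (1 ≤ q)] :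
    NormedAddCommGroup (W1q0 a b k q) := Submodule.normedAddCommGroup (W1q0 a b k q)

noncomputable instance instNormedSpaceW1q0 (a b : ℝ) (k : ℕ) (q : ℝ≥0∞) [Fact (1 ≤ q)] :
    NormedSpace ℝ (W1q0 a b k q) := Submodule.normedSpace (W1q0 a b k q)

/-- The admissible arcs `𝒳₁ = {y ∈ W^{1,q} | y(a) = A, y(b) = B}`. -/
def admissible (a b : ℝ) (k : ℕ) (q : ℝ≥0∞) [Fact (1 ≤ q)] (A B : E k) : Set (W1q a b k q) :=
  {y | HasEndpoints y A B}

/-! ### Sets ordered by `⊇` -/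

/-- The infimum in `𝒢(ℝᵈ, C)`, the closed convex sets stable under adding `C`, ordered by `⊇`. -/
def infG {d : ℕ} (S : Set (Set (E d))) : Set (E d) := closure (convexHull ℝ (⋃₀ S))

/-- The Aumann integral over `[a, b]` of a set-valued map. -/
def aumannIntegral {d : ℕ} (a b : ℝ) (F : ℝ → Set (E d)) : Set (E d) :=
  {z | ∃ f : ℝ → E d, IntegrableOn f (Icc a b) ∧ (∀ᵐ t ∂(μI a b), f t ∈ F t) ∧
    z = ∫ t in Icc a b, f t}

section Problem

variable {a b : ℝ} {n d : ℕ} {q : ℝ≥0∞} [Fact (1 ≤ q)]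

/-- `J(y) = ∫ₐᵇ L(t, y, ẏ) dt`. -/
noncomputable def J (L : ℝ × E n × E n → E d) (y : W1q a b n q) : E d :=
  ∫ t in Icc a b, L (t, fn y t, dot y t)

/-- The set-valued Lagrangian `L̄ = L + C`. -/
def Lbar (C : ProperCone ℝ (E d)) (L : ℝ × E n × E n → E d) (x : ℝ × E n × E n) : Set (E d) :=
  {L x} + (C : Set (E d))

/-- The set-valued functional `J̄(y) = ∫ₐᵇ L̄(t, y, ẏ) dt` (Aumann integral). -/
def Jbar (C : ProperCone ℝ (E d)) (L : ℝ × E n × E n → E d) (y : W1q a b n q) : Set (E d) :=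
  aumannIntegral a b (fun t => Lbar C L (t, fn y t, dot y t))

/-- `M ⊆ X` is an infimizer of `J̄` over `X`: `inf J̄[M] = inf J̄[X]`. -/
def IsInfimizer (C : ProperCone ℝ (E d)) (L : ℝ × E n × E n → E d)
    (X M : Set (W1q a b n q)) : Prop :=
  M ⊆ X ∧ infG (Jbar C L '' M) = infG (Jbar C L '' X)

/-- `y` is a `ζ`-solution over `X`: `y ∈ X` and `ζ · J(y) = inf {ζ · J̄(x) | x ∈ X}`, the infimum
being taken in the extended reals. -/
def IsZetaSolution (C : ProperCone ℝ (E d)) (L : ℝ × E n × E n → E d)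
    (X : Set (W1q a b n q)) (ζ : E d) (y : W1q a b n q) : Prop :=
  y ∈ X ∧ ((inner ℝ ζ (J L y) : ℝ) : EReal) =
    ⨅ x ∈ X, ⨅ z ∈ Jbar C L x, ((inner ℝ ζ z : ℝ) : EReal)

/-- The inf-translation `Ĵ(v; M) = inf_{y ∈ M} J̄(y + v)` for `v ∈ W_0^{1,q}`. -/
def infTranslation (C : ProperCone ℝ (E d)) (L : ℝ × E n × E n → E d)
    (M : Set (W1q a b n q)) (v : W1q0 a b n q) : Set (E d) :=
  infG ((fun y : W1q a b n q => Jbar C L (y + (v : W1q a b n q))) '' M)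

/-- The scalarization `φ_{ζ,M}(v) = inf {ζ · z | z ∈ Ĵ(v; M)}`, with values in `[-∞, ∞]`. -/
noncomputable def scalarization (C : ProperCone ℝ (E d)) (L : ℝ × E n × E n → E d)
    (M : Set (W1q a b n q)) (ζ : E d) (v : W1q0 a b n q) : EReal :=
  ⨅ z ∈ infTranslation C L M v, ((inner ℝ ζ z : ℝ) : EReal)

/-- The scalar Lagrangian `L_ζ = L · ζ`. -/
noncomputable def Lz (L : ℝ × E n × E n → E d) (ζ : E d) (x : ℝ × E n × E n) : ℝ :=
  inner ℝ ζ (L x)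

/-- The gradient `D_y f(t, y, p)` in the second variable. -/
noncomputable def Dy (f : ℝ × E n × E n → ℝ) (x : ℝ × E n × E n) : E n :=
  gradient (fun y => f (x.1, y, x.2.2)) x.2.1

/-- The gradient `D_p f(t, y, p)` in the third variable. -/
noncomputable def Dp (f : ℝ × E n × E n → ℝ) (x : ℝ × E n × E n) : E n :=
  gradient (fun p => f (x.1, x.2.1, p)) x.2.2

/-- The integrand `D_y L_ζ(t, y, ẏ) · v + D_p L_ζ(t, y, ẏ) · v̇` of the first variation. -/
noncomputable def firstVariation (L : ℝ × E n × E n → E d) (ζ : E d)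
    (y v : W1q a b n q) (t : ℝ) : ℝ :=
  inner ℝ (Dy (Lz L ζ) (t, fn y t, dot y t)) (fn v t) +
    inner ℝ (Dp (Lz L ζ) (t, fn y t, dot y t)) (dot v t)

/-- `y ∈ X` is a weak solution of the Euler-Lagrange equation
`d/dt D_p L_ζ(t, y, ẏ) = D_y L_ζ(t, y, ẏ)`. -/
def IsWeakSolution (L : ℝ × E n × E n → E d) (X : Set (W1q a b n q)) (ζ : E d)
    (y : W1q a b n q) : Prop :=
  y ∈ X ∧ ∀ v : W1q0 a b n q, IntegrableOn (firstVariation L ζ y v) (Icc a b) ∧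
    ∫ t in Icc a b, firstVariation L ζ y v t = 0

end Problem

/-- Fréchet differentiability at `x`, with derivative `f'`, of an extended real valued function:
`f` is finite near `x` and is Fréchet differentiable there as a real function. -/
def EHasFDerivAt {V : Type*} [NormedAddCommGroup V] [NormedSpace ℝ V] (f : V → EReal)
    (f' : V →L[ℝ] ℝ) (x : V) : Prop :=
  (∀ᶠ w in 𝓝 x, f w ≠ ⊤ ∧ f w ≠ ⊥) ∧ HasFDerivAt (fun w => (f w).toReal) f' x

end SetCalcVar

open SetCalcVar

/-!
Write `I y = ζ · J y`. Because `ζ` is nonnegative on the cone `C`, passing from `J` to `J̄ = J + C`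
and then to closed convex hulls does not change infima of `ζ ·`, so the scalarization at `v` is the
infimum of `I (y + v)` over `y ∈ M`. Each such `y + v` has the same endpoints as `y`, hence is
admissible and `I (y + v) ≥ I yζ`; taking `y = yζ` gives the upper bound. Thus
`I yζ ≤ φ v ≤ I (yζ + v)` for every `v ∈ W_0^{1,q}` (`le_scalarization`, `scalarization_le`).

The functional `I` is Fréchet differentiable at `yζ`, its derivative being the integral of the first
variation (`exists_abs_inner_J_sub_le`). Since `I` is minimal at `yζ` among the translates by
`W_0^{1,q}`, this derivative vanishes there (`eq_zero_of_nonneg_of_approx`): `yζ` is a weak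
solution of the Euler-Lagrange equation. The upper bound `I (yζ + v)` is therefore `I yζ + o(‖v‖)`,
and the squeeze makes `φ` differentiable at `0` with derivative zero
(`ehasFDerivAt_zero_of_squeeze`), which is the value of the integral of the first variation.

The analytic content is the differentiability of `w ↦ ∫ F(t, w(t)) dt` on `L^q` for an integrand
with `q`-growth whose derivative has `(q - 1)`-growth (`exists_abs_integral_remainder_le`). The
first-order remainder divided by `‖h(t)‖` is dominated by a power of `1 + ‖w(t)‖ + ‖h(t)‖` and tends
to zero pointwise along a subsequence of any null sequence in `L^q`, so it tends to zero in the
conjugate `L^{q'}` and Hölder's inequality concludes (`exists_lintegral_remainder_le`).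
-/

namespace SetCalcVar

/-! ### Remainder estimates in `L^q` -/

section Remainder

variable {α V : Type*} [MeasurableSpace α] {μ : Measure α} [NormedAddCommGroup V]

/-- The quotient of a remainder `R t h = o(h)` by its argument tends to zero along null sequences;
the junk value `0 / 0 = 0` agrees with `R t 0 = 0`. -/
theorem tendsto_enorm_div_enorm_of_isLittleO {ι : Type*} {l : Filter ι} {r : V → ℝ}
    (hr : r =o[𝓝 0] (fun h => h)) {h : ι → V} (hh : Tendsto h l (𝓝 0)) :
    Tendsto (fun k => ‖r (h k)‖ₑ / ‖h k‖ₑ) l (𝓝 0) := by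
  rw [ENNReal.tendsto_nhds_zero]
  intro ε hε
  obtain ⟨δ, hδ, hδε⟩ := ENNReal.lt_iff_exists_nnreal_btwn.1 hε
  have hδ0 : (0 : ℝ) < δ := by exact_mod_cast hδ
  filter_upwards [hh.eventually (hr.def hδ0)] with k hk
  refine (ENNReal.div_le_of_le_mul ?_).trans hδε.le
  rw [← ofReal_norm, ← ofReal_norm, ← ENNReal.ofReal_coe_nnreal,
    ← ENNReal.ofReal_mul δ.coe_nonneg]
  exact ENNReal.ofReal_le_ofReal hk

/-- Uniform smallness of the integral of a remainder. If `R t h = o(h)` for almost every `t` and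
`R` has `(q - 1)`-growth relative to its argument, then `∫ |R t (h t)| = o(‖h‖_q)`.
The quotients `|R t (h t)| / ‖h t‖` tend to zero in `L^{q'}`, with `q'` the exponent conjugate to
`q`, and Hölder's inequality applies. -/
theorem exists_lintegral_remainder_le {q : ℝ≥0∞} (hq1 : 1 < q) (hq : q < ∞) {R : α → V → ℝ}
    {w : α → ℝ≥0∞} (hwm : AEMeasurable w μ) (hw : ∫⁻ t, w t ^ q.toReal ∂μ ≠ ∞)
    {c : ℝ≥0∞} (hc : c ≠ ∞)
    (hR : ∀ᵐ t ∂μ, R t =o[𝓝 0] (fun h => h))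
    (hRb : ∀ᵐ t ∂μ, ∀ h, ‖R t h‖ₑ ≤ c * (w t + ‖h‖ₑ) ^ (q.toReal - 1) * ‖h‖ₑ)
    {ε : ℝ≥0∞} (hε : 0 < ε) :
    ∃ δ > 0, ∀ h : α → V, AEStronglyMeasurable h μ →
      AEStronglyMeasurable (fun t => R t (h t)) μ → eLpNorm h q μ < δ →
      ∫⁻ t, ‖R t (h t)‖ₑ ∂μ ≤ ε * eLpNorm h q μ := by
  set p := q.toReal with hp
  have hp1 : 1 < p := by
    rw [hp]; exact (ENNReal.toReal_lt_toReal ENNReal.one_ne_top hq.ne).2 hq1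
  have hp0 : 0 < p := zero_lt_one.trans hp1
  have hq0 : q ≠ 0 := (zero_lt_one.trans hq1).ne'
  -- negating yields a null sequence violating the estimate; the tolerance `0⁻¹ = ∞` is harmless
  by_contra! hcon
  have hpos (k : ℕ) : (0 : ℝ≥0∞) < (k : ℝ≥0∞)⁻¹ := ENNReal.inv_pos.2 (ENNReal.natCast_ne_top k)
  choose h hm hRm hδ hlt using fun k : ℕ => hcon (k : ℝ≥0∞)⁻¹ (hpos k)
  have hlim : Tendsto (fun k => eLpNorm (h k) q μ) atTop (𝓝 0) :=
    tendsto_of_tendsto_of_tendsto_of_le_of_le tendsto_const_nhds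
      ENNReal.tendsto_inv_nat_nhds_zero (fun _ => zero_le) fun k => (hδ k).le
  obtain ⟨ns, hns, hae⟩ := (tendstoInMeasure_of_tendsto_eLpNorm hq0 hm
    (aestronglyMeasurable_zero (β := V)) (by simpa using hlim)).exists_seq_tendsto_ae
  set s := p.conjExponent with hs
  have hps : p.HolderConjugate s := Real.HolderConjugate.conjExponent hp1
  have hs0 : 0 < s := hps.symm.pos
  have hexp : (p - 1) * s = p := hps.sub_one_mul_conj
  -- the quotients, and the constant in their growth bound after taking the power `s`
  let ρ : ℕ → α → ℝ≥0∞ := fun k t => ‖R t (h (ns k) t)‖ₑ / ‖h (ns k) t‖ₑ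
  let D : ℝ≥0∞ := c ^ s * 2 ^ (p - 1)
  have hD : D ≠ ∞ := ENNReal.mul_ne_top (ENNReal.rpow_ne_top_of_nonneg hs0.le hc)
    (ENNReal.rpow_ne_top_of_nonneg (by linarith) (by simp))
  have hρm (k : ℕ) : AEMeasurable (ρ k) μ := (hRm _).enorm.div (hm _).enorm
  have hρ0 : ∀ᵐ t ∂μ, Tendsto (fun k => ρ k t ^ s) atTop (𝓝 0) := by
    filter_upwards [hR, hae] with t h1 h2
    have := tendsto_enorm_div_enorm_of_isLittleO h1 h2
    have := (ENNReal.continuous_rpow_const (y := s)).tendsto 0 |>.comp this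
    rwa [ENNReal.zero_rpow_of_pos hs0] at this
  have hρb (k : ℕ) : ∀ᵐ t ∂μ, ρ k t ^ s ≤ D * w t ^ p + D * ‖h (ns k) t‖ₑ ^ p := by
    filter_upwards [hRb] with t ht
    calc ρ k t ^ s ≤ (c * (w t + ‖h (ns k) t‖ₑ) ^ (p - 1)) ^ s := by
          gcongr; exact ENNReal.div_le_of_le_mul (ht _)
      _ = c ^ s * (w t + ‖h (ns k) t‖ₑ) ^ p := by
          rw [ENNReal.mul_rpow_of_nonneg _ _ hs0.le, ← ENNReal.rpow_mul, hexp]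
      _ ≤ c ^ s * (2 ^ (p - 1) * (w t ^ p + ‖h (ns k) t‖ₑ ^ p)) := by
          gcongr; exact ENNReal.rpow_add_le_mul_rpow_add_rpow _ _ hp1.le
      _ = _ := by simp only [D]; ring
  have hhp (k : ℕ) : ∫⁻ t, ‖h (ns k) t‖ₑ ^ p ∂μ = eLpNorm (h (ns k)) q μ ^ p := by
    rw [eLpNorm_eq_lintegral_rpow_enorm_toReal hq0 hq.ne, ← ENNReal.rpow_mul,
      one_div_mul_cancel hp0.ne', ENNReal.rpow_one]
  -- truncated subtraction turns the growth bound into a dominating function independent of `k`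
  have hψ : Tendsto (fun k => ∫⁻ t, (ρ k t ^ s - D * ‖h (ns k) t‖ₑ ^ p) ∂μ) atTop (𝓝 0) := by
    rw [← lintegral_zero (μ := μ)]
    refine tendsto_lintegral_of_dominated_convergence' (fun t => D * w t ^ p) (fun k => ?_)
      (fun k => ?_) ?_ ?_
    · exact ((hρm k).pow_const _).sub (((hm _).enorm.pow_const _).const_mul _)
    · filter_upwards [hρb k] with t ht
      exact tsub_le_iff_right.2 ht
    · rw [lintegral_const_mul'' _ (hwm.pow_const _)]
      exact ENNReal.mul_ne_top hD hw
    · filter_upwards [hρ0] with t ht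
      exact tendsto_of_tendsto_of_tendsto_of_le_of_le tendsto_const_nhds ht
        (fun _ => zero_le) fun _ => tsub_le_self
  have hρlim : Tendsto (fun k => (∫⁻ t, ρ k t ^ s ∂μ) ^ (1 / s)) atTop (𝓝 0) := by
    have hN : Tendsto (fun k => D * eLpNorm (h (ns k)) q μ ^ p) atTop (𝓝 0) := by
      have h1 := (ENNReal.continuous_rpow_const (y := p)).tendsto 0 |>.comp
        (hlim.comp hns.tendsto_atTop)
      rw [ENNReal.zero_rpow_of_pos hp0] at h1
      simpa using ENNReal.Tendsto.const_mul h1 (Or.inr hD)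
    have hsum : Tendsto (fun k => ∫⁻ t, ρ k t ^ s ∂μ) atTop (𝓝 0) := by
      refine tendsto_of_tendsto_of_tendsto_of_le_of_le tendsto_const_nhds
        (by simpa using hψ.add hN) (fun _ => zero_le) fun k => ?_
      calc ∫⁻ t, ρ k t ^ s ∂μ
          ≤ ∫⁻ t, ((ρ k t ^ s - D * ‖h (ns k) t‖ₑ ^ p) + D * ‖h (ns k) t‖ₑ ^ p) ∂μ :=
            lintegral_mono fun t => le_tsub_add
        _ = _ := by
            rw [lintegral_add_right' _ (((hm _).enorm.pow_const _).const_mul _),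
              lintegral_const_mul'' _ ((hm _).enorm.pow_const _), hhp]
    have := (ENNReal.continuous_rpow_const (y := 1 / s)).tendsto 0 |>.comp hsum
    rwa [ENNReal.zero_rpow_of_pos (by positivity)] at this
  obtain ⟨k, hk⟩ := (ENNReal.tendsto_nhds_zero.1 hρlim ε hε).exists
  refine (hlt (ns k)).not_ge ?_
  calc ∫⁻ t, ‖R t (h (ns k) t)‖ₑ ∂μ
      = ∫⁻ t, (ρ k * fun t => ‖h (ns k) t‖ₑ) t ∂μ := by
        refine lintegral_congr_ae ?_
        filter_upwards [hRb] with t ht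
        rcases eq_or_ne (h (ns k) t) 0 with h0 | h0
        · have := ht 0
          simp only [enorm_zero, mul_zero, nonpos_iff_eq_zero] at this
          simp [ρ, h0, this]
        · simp only [ρ, Pi.mul_apply]
          rw [ENNReal.div_mul_cancel (by simpa using h0) enorm_ne_top]
    _ ≤ (∫⁻ t, ρ k t ^ s ∂μ) ^ (1 / s) * (∫⁻ t, ‖h (ns k) t‖ₑ ^ p ∂μ) ^ (1 / p) :=
        ENNReal.lintegral_mul_le_Lp_mul_Lq μ hps.symm (hρm k) (hm _).enorm
    _ ≤ ε * eLpNorm (h (ns k)) q μ := by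
        rw [eLpNorm_eq_lintegral_rpow_enorm_toReal hq0 hq.ne]
        gcongr

end Remainder

/-! ### The Lagrangian at a fixed time -/

section Lagrangian

variable {n d : ℕ} {a b : ℝ}

theorem fderiv_section_apply (f : ℝ × E n × E n → ℝ) (t : ℝ) (u h : E n × E n)
    (hf : DifferentiableAt ℝ (fun w => f (t, w)) u) :
    fderiv ℝ (fun w => f (t, w)) u h =
      inner ℝ (Dy f (t, u)) h.1 + inner ℝ (Dp f (t, u)) h.2 := by
  have hy : HasFDerivAt (fun y => f (t, y, u.2))
      ((fderiv ℝ (fun w => f (t, w)) u).comp (.inl ℝ (E n) (E n))) u.1 :=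
    HasFDerivAt.comp u.1 (f := fun y => (y, u.2)) (g := fun w => f (t, w)) hf.hasFDerivAt
      (hasFDerivAt_prodMk_left u.1 u.2)
  have hp : HasFDerivAt (fun p => f (t, u.1, p))
      ((fderiv ℝ (fun w => f (t, w)) u).comp (.inr ℝ (E n) (E n))) u.2 :=
    HasFDerivAt.comp u.2 (f := fun p => (u.1, p)) (g := fun w => f (t, w)) hf.hasFDerivAt
      (hasFDerivAt_prodMk_right u.1 u.2)
  rw [Dy, Dp, hy.hasGradientAt.gradient, hp.hasGradientAt.gradient]
  simp [← map_add]

theorem differentiable_section {L : ℝ × E n × E n → E d}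
    (hL : ContDiffOn ℝ 1 L (Icc a b ×ˢ univ)) {t : ℝ} (ht : t ∈ Icc a b) :
    Differentiable ℝ (fun w => L (t, w)) := by
  have h : ContDiffOn ℝ 1 (fun w : E n × E n => L (t, w)) univ :=
    hL.comp (contDiffOn_const.prodMk contDiffOn_id) fun w _ => ⟨ht, mem_univ _⟩
  exact (contDiffOn_univ.1 h).differentiable one_ne_zero

theorem add_add_one_rpow_le {x y r s : ℝ} (hs : 0 ≤ s) (hx : 0 ≤ x) (hy : 0 ≤ y)
    (hxr : x ≤ r) (hyr : y ≤ r) : x ^ s + y ^ s + 1 ≤ 3 * (r + 1) ^ s := by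
  have h1 : x ^ s ≤ (r + 1) ^ s := Real.rpow_le_rpow hx (by linarith) hs
  have h2 : y ^ s ≤ (r + 1) ^ s := Real.rpow_le_rpow hy (by linarith) hs
  have h3 : 1 ≤ (r + 1) ^ s := Real.one_le_rpow (by linarith) hs
  linarith

theorem abs_mul_add_add_one_le {x y r s z K : ℝ} (hs : 0 ≤ s) (hx : 0 ≤ x) (hy : 0 ≤ y)
    (hxr : x ≤ r) (hyr : y ≤ r) (hz : z ≤ K * (x ^ s + y ^ s + 1)) :
    z ≤ 3 * |K| * (r + 1) ^ s := by
  have h := add_add_one_rpow_le hs hx hy hxr hyr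
  have h0 : 0 ≤ x ^ s + y ^ s + 1 := by positivity
  calc z ≤ |K| * (x ^ s + y ^ s + 1) := hz.trans (by gcongr; exact le_abs_self K)
    _ ≤ |K| * (3 * (r + 1) ^ s) := by gcongr
    _ = _ := by ring

theorem norm_le_card_mul {x : E d} {c : ℝ} (h : ∀ i, |x i| ≤ c) : ‖x‖ ≤ d * c := by
  rw [← (EuclideanSpace.basisFun (Fin d) ℝ).sum_repr x]
  refine (norm_sum_le _ _).trans ?_
  calc _ ≤ ∑ _i : Fin d, c := by
        refine Finset.sum_le_sum fun i _ => ?_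
        simpa [norm_smul] using h i
    _ = _ := by simp

/-- The growth condition on `L`, in one norm. -/
theorem norm_lagrangian_le {L : ℝ × E n × E n → E d} {s K : ℝ} (hs : 0 ≤ s) {t : ℝ}
    (hK : ∀ i : Fin d, ∀ y p : E n, |L (t, y, p) i| ≤ K * (‖y‖ ^ s + ‖p‖ ^ s + 1))
    (u : E n × E n) : ‖L (t, u)‖ ≤ d * (3 * |K|) * (‖u‖ + 1) ^ s := by
  rw [mul_assoc]
  exact norm_le_card_mul fun i => abs_mul_add_add_one_le hs (norm_nonneg _) (norm_nonneg _)
    (norm_fst_le u) (norm_snd_le u) (hK i u.1 u.2)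

/-- The growth conditions on the partial derivatives of `L`, as a bound on the full derivative in
the state and velocity variables. -/
theorem norm_fderiv_section_le {L : ℝ × E n × E n → E d}
    {s K : ℝ} (hs : 0 ≤ s) {t : ℝ} (hL : Differentiable ℝ (fun w => L (t, w)))
    (hKp : ∀ i : Fin d, ∀ y p : E n,
      ‖Dp (fun x => L x i) (t, y, p)‖ ≤ K * (‖y‖ ^ s + ‖p‖ ^ s + 1))
    (hKy : ∀ i : Fin d, ∀ y p : E n,
      ‖Dy (fun x => L x i) (t, y, p)‖ ≤ K * (‖y‖ ^ s + ‖p‖ ^ s + 1))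
    (u : E n × E n) :
    ‖fderiv ℝ (fun w => L (t, w)) u‖ ≤ d * (6 * |K|) * (‖u‖ + 1) ^ s := by
  refine ContinuousLinearMap.opNorm_le_bound _ (by positivity) fun h => ?_
  rw [show d * (6 * |K|) * (‖u‖ + 1) ^ s * ‖h‖
    = d * (3 * |K| * (‖u‖ + 1) ^ s * ‖h‖ + 3 * |K| * (‖u‖ + 1) ^ s * ‖h‖) by ring]
  refine norm_le_card_mul fun i => ?_
  have hi : HasFDerivAt (fun w => L (t, w) i)
      ((EuclideanSpace.proj i).comp (fderiv ℝ (fun w => L (t, w)) u)) u :=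
    (EuclideanSpace.proj (𝕜 := ℝ) i).hasFDerivAt.comp u (hL u).hasFDerivAt
  have e := fderiv_section_apply (fun x => L x i) t u h hi.differentiableAt
  rw [hi.fderiv] at e
  have e' : (fderiv ℝ (fun w => L (t, w)) u h) i = _ := e
  rw [e']
  refine (abs_add_le _ _).trans (add_le_add ?_ ?_) <;>
    refine (abs_real_inner_le_norm _ _).trans (mul_le_mul ?_ ?_ (norm_nonneg _) (by positivity))
  · exact abs_mul_add_add_one_le hs (norm_nonneg _) (norm_nonneg _)
      (norm_fst_le u) (norm_snd_le u) (hKy i u.1 u.2)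
  · exact norm_fst_le h
  · exact abs_mul_add_add_one_le hs (norm_nonneg _) (norm_nonneg _)
      (norm_fst_le u) (norm_snd_le u) (hKp i u.1 u.2)
  · exact norm_snd_le h

/-- First-order remainder of a differentiable function whose derivative has `s`-growth. -/
theorem abs_remainder_le {V : Type*} [NormedAddCommGroup V] [NormedSpace ℝ V] {f : V → ℝ}
    {s K : ℝ} (hs : 0 ≤ s) (hK0 : 0 ≤ K) (hf : Differentiable ℝ f)
    (hK : ∀ w, ‖fderiv ℝ f w‖ ≤ K * (‖w‖ + 1) ^ s) (u h : V) :
    |f (u + h) - f u - fderiv ℝ f u h| ≤ 2 * K * (‖u‖ + 1 + ‖h‖) ^ s * ‖h‖ := by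
  have hball : ∀ w ∈ Metric.closedBall (0 : V) (‖u‖ + ‖h‖),
      ‖fderiv ℝ f w‖ ≤ K * (‖u‖ + 1 + ‖h‖) ^ s := by
    intro w hw
    rw [mem_closedBall_zero_iff] at hw
    refine (hK w).trans ?_
    gcongr K * ?_ ^ s
    linarith
  have hu : u ∈ Metric.closedBall (0 : V) (‖u‖ + ‖h‖) := by
    rw [mem_closedBall_zero_iff]; linarith [norm_nonneg h]
  have huh : u + h ∈ Metric.closedBall (0 : V) (‖u‖ + ‖h‖) := by
    rw [mem_closedBall_zero_iff]; exact norm_add_le u h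
  have h1 := (convex_closedBall (0 : V) (‖u‖ + ‖h‖)).norm_image_sub_le_of_norm_hasFDerivWithin_le
    (fun w _ => (hf w).hasFDerivAt.hasFDerivWithinAt) hball hu huh
  have h2 := (fderiv ℝ f u).le_of_opNorm_le (hball u hu) h
  rw [add_sub_cancel_left] at h1
  calc |f (u + h) - f u - fderiv ℝ f u h|
      ≤ |f (u + h) - f u| + |fderiv ℝ f u h| := abs_sub _ _
    _ ≤ _ := by
        rw [Real.norm_eq_abs] at h1 h2
        linarith

end Lagrangian

/-! ### Differentiability of integral functionals on `L^q` -/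

section Nemytskii

variable {V W : Type*} [NormedAddCommGroup V] [NormedAddCommGroup W] {a b : ℝ} {q : ℝ≥0∞}

/-- A Carathéodory-type measurability statement; extending the integrand from `[a, b]` to `ℝ` by
projection makes it continuous everywhere. -/
theorem aestronglyMeasurable_comp_of_continuousOn (hab : a ≤ b) {F : ℝ × V → W}
    (hF : ContinuousOn F (Icc a b ×ˢ univ)) {w : ℝ → V}
    (hw : AEStronglyMeasurable w (μI a b)) :
    AEStronglyMeasurable (fun t => F (t, w t)) (μI a b) := by
  have hc : Continuous fun x : ℝ × V => F ((projIcc a b hab x.1 : ℝ), x.2) :=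
    hF.comp_continuous (by fun_prop) fun x => ⟨(projIcc a b hab x.1).2, mem_univ _⟩
  refine (hc.comp_aestronglyMeasurable
    (aestronglyMeasurable_id.prodMk hw)).congr ?_
  filter_upwards [ae_restrict_mem measurableSet_Icc] with t ht
  simp [projIcc_of_mem hab ht]

theorem memLp_norm_add_one {w : ℝ → V} (hw : MemLp w q (μI a b)) :
    MemLp (fun t => ‖w t‖ + 1) q (μI a b) :=
  hw.norm.add (memLp_const 1)

theorem integrable_norm_add_one_rpow (hq1 : 1 < q) (hq : q < ∞) {w : ℝ → V}
    (hw : MemLp w q (μI a b)) : Integrable (fun t => (‖w t‖ + 1) ^ q.toReal) (μI a b) := by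
  refine ((memLp_norm_add_one hw).integrable_norm_rpow (zero_lt_one.trans hq1).ne' hq.ne).congr ?_
  filter_upwards with t
  rw [Real.norm_of_nonneg (by positivity)]

/-- The superposition operator of an integrand with `q`-growth maps `L^q` to `L^1`. -/
theorem integrable_superposition (hab : a ≤ b) (hq1 : 1 < q) (hq : q < ∞) {F : ℝ × V → W} {K : ℝ}
    (hF : ContinuousOn F (Icc a b ×ˢ univ))
    (hK : ∀ t ∈ Icc a b, ∀ u, ‖F (t, u)‖ ≤ K * (‖u‖ + 1) ^ q.toReal) {w : ℝ → V}
    (hw : MemLp w q (μI a b)) : Integrable (fun t => F (t, w t)) (μI a b) := by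
  refine ((integrable_norm_add_one_rpow hq1 hq hw).const_mul K).mono'
    (aestronglyMeasurable_comp_of_continuousOn hab hF hw.1) ?_
  filter_upwards [ae_restrict_mem measurableSet_Icc] with t ht
  exact hK t ht _

variable [NormedSpace ℝ V]

/-- The directional derivative along an `L^q` function is measurable as a limit of difference
quotients. -/
theorem aestronglyMeasurable_fderiv_section (hab : a ≤ b) {F : ℝ × V → ℝ}
    (hF : ContinuousOn F (Icc a b ×ˢ univ))
    (hd : ∀ t ∈ Icc a b, Differentiable ℝ fun u => F (t, u)) {w h : ℝ → V}
    (hw : AEStronglyMeasurable w (μI a b)) (hh : AEStronglyMeasurable h (μI a b)) :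
    AEStronglyMeasurable (fun t => fderiv ℝ (fun u => F (t, u)) (w t) (h t)) (μI a b) := by
  have hs : Tendsto (fun k : ℕ => ((k : ℝ) + 1)⁻¹) atTop (𝓝[≠] 0) := by
    refine tendsto_nhdsWithin_iff.2 ⟨?_, ?_⟩
    · simpa using tendsto_one_div_add_atTop_nhds_zero_nat (𝕜 := ℝ)
    · filter_upwards with k
      exact inv_ne_zero (by positivity)
  refine aestronglyMeasurable_of_tendsto_ae atTop (f := fun (k : ℕ) t =>
    (((k : ℝ) + 1)⁻¹)⁻¹ • (F (t, w t + ((k : ℝ) + 1)⁻¹ • h t) - F (t, w t))) (fun k => ?_) ?_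
  · have hk : AEStronglyMeasurable (fun t => w t + ((k : ℝ) + 1)⁻¹ • h t) (μI a b) :=
      hw.add (hh.const_smul ((k : ℝ) + 1)⁻¹)
    have hdiff := (aestronglyMeasurable_comp_of_continuousOn hab hF hk).sub
      (aestronglyMeasurable_comp_of_continuousOn hab hF hw)
    exact hdiff.const_smul (((k : ℝ) + 1)⁻¹)⁻¹
  · filter_upwards [ae_restrict_mem measurableSet_Icc] with t ht
    exact (((hd t ht (w t)).hasFDerivAt.hasLineDerivAt (h t)).tendsto_slope_zero).comp hs

theorem integrable_fderiv_section (hab : a ≤ b) (hq1 : 1 < q) (hq : q < ∞) {F : ℝ × V → ℝ} {K : ℝ}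
    (hF : ContinuousOn F (Icc a b ×ˢ univ))
    (hd : ∀ t ∈ Icc a b, Differentiable ℝ fun u => F (t, u)) (hK0 : 0 ≤ K)
    (hK : ∀ t ∈ Icc a b, ∀ u,
      ‖fderiv ℝ (fun u => F (t, u)) u‖ ≤ K * (‖u‖ + 1) ^ (q.toReal - 1)) {w h : ℝ → V}
    (hw : MemLp w q (μI a b)) (hh : MemLp h q (μI a b)) :
    Integrable (fun t => fderiv ℝ (fun u => F (t, u)) (w t) (h t)) (μI a b) := by
  have hp1 : 1 < q.toReal := (ENNReal.toReal_lt_toReal ENNReal.one_ne_top hq.ne).2 hq1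
  refine ((integrable_norm_add_one_rpow hq1 hq (hw.norm.add hh.norm)).const_mul K).mono'
    (aestronglyMeasurable_fderiv_section hab hF hd hw.1 hh.1) ?_
  filter_upwards [ae_restrict_mem measurableSet_Icc] with t ht
  have hpos : 0 < ‖w t‖ + ‖h t‖ + 1 := by positivity
  calc ‖fderiv ℝ (fun u => F (t, u)) (w t) (h t)‖
      ≤ K * (‖w t‖ + 1) ^ (q.toReal - 1) * ‖h t‖ :=
        (fderiv ℝ (fun u => F (t, u)) (w t)).le_of_opNorm_le (hK t ht _) _
    _ ≤ K * (‖w t‖ + ‖h t‖ + 1) ^ (q.toReal - 1) * (‖w t‖ + ‖h t‖ + 1) := by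
        have hw0 := norm_nonneg (w t)
        have hh0 := norm_nonneg (h t)
        gcongr <;> linarith
    _ = K * (‖w t‖ + ‖h t‖ + 1) ^ q.toReal := by
        rw [mul_assoc, ← Real.rpow_add_one hpos.ne', sub_add_cancel]
    _ = _ := by
        simp only [Pi.add_apply]
        rw [Real.norm_of_nonneg (add_nonneg (norm_nonneg _) (norm_nonneg _))]

/-- The integral functional `w ↦ ∫ F(t, w(t)) dt` is Fréchet differentiable on `L^q`. -/
theorem exists_abs_integral_remainder_le (hab : a ≤ b) (hq1 : 1 < q) (hq : q < ∞)
    {F : ℝ × V → ℝ} {K₀ K : ℝ} (hF : ContinuousOn F (Icc a b ×ˢ univ))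
    (hK₀ : ∀ t ∈ Icc a b, ∀ u, ‖F (t, u)‖ ≤ K₀ * (‖u‖ + 1) ^ q.toReal)
    (hd : ∀ t ∈ Icc a b, Differentiable ℝ fun u => F (t, u)) (hK0 : 0 ≤ K)
    (hK : ∀ t ∈ Icc a b, ∀ u,
      ‖fderiv ℝ (fun u => F (t, u)) u‖ ≤ K * (‖u‖ + 1) ^ (q.toReal - 1)) {w : ℝ → V}
    (hw : MemLp w q (μI a b)) {ε : ℝ} (hε : 0 < ε) :
    ∃ δ > 0, ∀ h : ℝ → V, MemLp h q (μI a b) → eLpNorm h q (μI a b) < δ →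
      |(∫ t in Icc a b, F (t, w t + h t)) - (∫ t in Icc a b, F (t, w t)) -
        ∫ t in Icc a b, fderiv ℝ (fun u => F (t, u)) (w t) (h t)| ≤
        ε * (eLpNorm h q (μI a b)).toReal := by
  have hp1 : 1 < q.toReal := (ENNReal.toReal_lt_toReal ENNReal.one_ne_top hq.ne).2 hq1
  have hs : 0 ≤ q.toReal - 1 := by linarith
  have hq0 : q ≠ 0 := (zero_lt_one.trans hq1).ne'
  let R : ℝ → V → ℝ := fun t h =>
    F (t, w t + h) - F (t, w t) - fderiv ℝ (fun u => F (t, u)) (w t) h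
  have hwm := memLp_norm_add_one hw
  have hR : ∀ᵐ t ∂(μI a b), R t =o[𝓝 0] (fun h => h) := by
    filter_upwards [ae_restrict_mem measurableSet_Icc] with t ht
    exact hasFDerivAt_iff_isLittleO_nhds_zero.1 (hd t ht (w t)).hasFDerivAt
  have hRb : ∀ᵐ t ∂(μI a b), ∀ h, ‖R t h‖ₑ ≤
      ENNReal.ofReal (2 * K) * (‖‖w t‖ + 1‖ₑ + ‖h‖ₑ) ^ (q.toReal - 1) * ‖h‖ₑ := by
    filter_upwards [ae_restrict_mem measurableSet_Icc] with t ht h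
    have h1 := abs_remainder_le hs hK0 (hd t ht) (hK t ht) (w t) h
    rw [← ofReal_norm, ← ofReal_norm, ← ofReal_norm, Real.norm_of_nonneg (r := ‖w t‖ + 1)
      (by positivity), ← ENNReal.ofReal_add (by positivity) (by positivity),
      ENNReal.ofReal_rpow_of_nonneg (by positivity) hs, ← ENNReal.ofReal_mul (by positivity),
      ← ENNReal.ofReal_mul (by positivity)]
    exact ENNReal.ofReal_le_ofReal h1
  have hwfin : ∫⁻ t, ‖‖w t‖ + 1‖ₑ ^ q.toReal ∂(μI a b) ≠ ∞ :=
    ((eLpNorm_lt_top_iff_lintegral_rpow_enorm_lt_top hq0 hq.ne).1 hwm.2).ne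
  obtain ⟨δ, hδ, hmain⟩ := exists_lintegral_remainder_le hq1 hq hwm.1.enorm hwfin
    ENNReal.ofReal_ne_top hR hRb (ENNReal.ofReal_pos.2 hε)
  refine ⟨δ, hδ, fun h hh hlt => ?_⟩
  have i1 := integrable_superposition hab hq1 hq hF hK₀ (hw.add hh)
  have i2 := integrable_superposition hab hq1 hq hF hK₀ hw
  have i3 := integrable_fderiv_section hab hq1 hq hF hd hK0 hK hw hh
  have e : (∫ t in Icc a b, F (t, w t + h t)) - (∫ t in Icc a b, F (t, w t)) -
      ∫ t in Icc a b, fderiv ℝ (fun u => F (t, u)) (w t) (h t) = ∫ t in Icc a b, R t (h t) := by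
    rw [← integral_sub, ← integral_sub]
    exacts [i1.sub i2, i3, i1, i2]
  rw [e, ← Real.norm_eq_abs]
  refine (norm_integral_le_lintegral_norm _).trans ?_
  rw [← ENNReal.toReal_ofReal hε.le, ← ENNReal.toReal_mul]
  refine ENNReal.toReal_mono (ENNReal.mul_ne_top ENNReal.ofReal_ne_top hh.2.ne) ?_
  simp_rw [ofReal_norm]
  exact hmain h hh.1 ((i1.sub i2).sub i3).1 hlt

end Nemytskii

/-! ### Arcs as `L^q` functions -/

section Arc

variable {a b : ℝ} {n d : ℕ} {q : ℝ≥0∞} [Fact (1 ≤ q)]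

/-- The pair `t ↦ (y(t), ẏ(t))` of an arc and its weak derivative, with the supremum norm on
`ℝⁿ × ℝⁿ`. -/
noncomputable def arc (y : W1q a b n q) (t : ℝ) : E n × E n := (fn y t, dot y t)

theorem memLp_arc (y : W1q a b n q) : MemLp (arc y) q (μI a b) :=
  MemLp.of_fst_snd ⟨Lp.memLp y.1.fst, Lp.memLp y.1.snd⟩

theorem arc_add (y v : W1q a b n q) : arc (y + v) =ᵐ[μI a b] fun t => arc y t + arc v t := by
  filter_upwards [Lp.coeFn_add y.1.fst v.1.fst, Lp.coeFn_add y.1.snd v.1.snd] with t h1 h2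
  exact Prod.ext h1 h2

theorem arc_smul (s : ℝ) (v : W1q a b n q) : arc (s • v) =ᵐ[μI a b] fun t => s • arc v t := by
  filter_upwards [Lp.coeFn_smul s v.1.fst, Lp.coeFn_smul s v.1.snd] with t h1 h2
  exact Prod.ext h1 h2

theorem eLpNorm_arc_le (v : W1q a b n q) :
    eLpNorm (arc v) q (μI a b) ≤ ENNReal.ofReal (2 * ‖v‖) := by
  have h1 : eLpNorm (fn v) q (μI a b) ≤ ENNReal.ofReal ‖v‖ := by
    rw [ofReal_norm]
    exact (Lp.enorm_def v.1.fst).symm.trans_le (WithLp.enorm_fst_le _ v.1)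
  have h2 : eLpNorm (dot v) q (μI a b) ≤ ENNReal.ofReal ‖v‖ := by
    rw [ofReal_norm]
    exact (Lp.enorm_def v.1.snd).symm.trans_le (WithLp.enorm_snd_le _ v.1)
  calc eLpNorm (arc v) q (μI a b)
      ≤ eLpNorm ((fun t => ‖fn v t‖) + fun t => ‖dot v t‖) q (μI a b) := by
        refine eLpNorm_mono fun t => ?_
        rw [Pi.add_apply, Real.norm_of_nonneg (add_nonneg (norm_nonneg _) (norm_nonneg _)),
          arc, Prod.norm_mk]
        exact max_le (le_add_of_nonneg_right (norm_nonneg _))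
          (le_add_of_nonneg_left (norm_nonneg _))
    _ ≤ eLpNorm (fn v) q (μI a b) + eLpNorm (dot v) q (μI a b) := by
        rw [← eLpNorm_norm (fn v), ← eLpNorm_norm (dot v)]
        exact eLpNorm_add_le (Lp.memLp v.1.fst).1.norm (Lp.memLp v.1.snd).1.norm Fact.out
    _ ≤ ENNReal.ofReal ‖v‖ + ENNReal.ofReal ‖v‖ := add_le_add h1 h2
    _ = ENNReal.ofReal (2 * ‖v‖) := by
        rw [← ENNReal.ofReal_add (norm_nonneg _) (norm_nonneg _), two_mul]

theorem add_mem_admissible {A B : E n} {y : W1q a b n q} (hy : y ∈ admissible a b n q A B)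
    (v : W1q0 a b n q) : y + (v : W1q a b n q) ∈ admissible a b n q A B := by
  obtain ⟨f, hf, hyf, fa, fb⟩ := hy
  obtain ⟨g, hg, hvg, ga, gb⟩ := v.2
  refine ⟨f + g, hf.add hg, ?_, by simp [fa, ga], by simp [fb, gb]⟩
  exact (Lp.coeFn_add y.1.fst (v : W1q a b n q).1.fst).trans (hyf.add hvg)

end Arc

/-! ### The scalarized inf-translation -/

section Scalarization

variable {a b : ℝ} {n d : ℕ} {q : ℝ≥0∞} [Fact (1 ≤ q)] {C : ProperCone ℝ (E d)}
  {L : ℝ × E n × E n → E d} {ζ : E d}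

theorem J_mem_Jbar {y : W1q a b n q} (hL : Integrable (fun t => L (t, arc y t)) (μI a b)) :
    J L y ∈ Jbar C L y :=
  ⟨fun t => L (t, arc y t), hL, ae_of_all _ fun t =>
    ⟨L (t, arc y t), rfl, 0, C.zero_mem, add_zero _⟩, rfl⟩

theorem inner_J {y : W1q a b n q} (hL : Integrable (fun t => L (t, arc y t)) (μI a b)) :
    inner ℝ ζ (J L y) = ∫ t in Icc a b, Lz L ζ (t, arc y t) :=
  (integral_inner hL ζ).symm

theorem inner_J_le_of_mem_Jbar (hζ : ζ ∈ ProperCone.innerDual (C : Set (E d))) {y : W1q a b n q}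
    (hL : Integrable (fun t => L (t, arc y t)) (μI a b)) {z : E d} (hz : z ∈ Jbar C L y) :
    inner ℝ ζ (J L y) ≤ inner ℝ ζ z := by
  obtain ⟨f, hf, hfL, rfl⟩ := hz
  rw [inner_J hL, ← integral_inner hf]
  refine integral_mono_ae (hL.const_inner ζ) (Integrable.const_inner ζ hf) ?_
  filter_upwards [hfL] with t ht
  obtain ⟨l, rfl, c, hc, hlc⟩ := ht
  have h0 : 0 ≤ inner ℝ ζ c := by
    rw [real_inner_comm]; exact ProperCone.mem_innerDual.1 hζ hc
  have h1 : inner ℝ ζ (f t) = inner ℝ ζ (L (t, fn y t, dot y t)) + inner ℝ ζ c := by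
    rw [← inner_add_right]; exact congrArg _ hlc.symm
  change inner ℝ ζ (L (t, fn y t, dot y t)) ≤ inner ℝ ζ (f t)
  linarith

/-- Taking the closed convex hull does not lower the infimum of a linear functional. -/
theorem le_inner_of_mem_infG {S : Set (Set (E d))} {m : ℝ}
    (h : ∀ s ∈ S, ∀ z ∈ s, m ≤ inner ℝ ζ z) {z : E d} (hz : z ∈ infG S) : m ≤ inner ℝ ζ z := by
  have hc : IsClosed {z : E d | m ≤ inner ℝ ζ z} :=
    isClosed_le continuous_const (by fun_prop)
  have hconv : Convex ℝ {z : E d | m ≤ inner ℝ ζ z} :=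
    convex_halfSpace_ge (innerSL ℝ ζ).toLinearMap.isLinear m
  exact closure_minimal (convexHull_min (sUnion_subset fun s hs z hz => h s hs z hz) hconv) hc hz

theorem scalarization_le {M : Set (W1q a b n q)} {y : W1q a b n q} (hy : y ∈ M)
    (v : W1q0 a b n q)
    (hL : Integrable (fun t => L (t, arc (y + (v : W1q a b n q)) t)) (μI a b)) :
    scalarization C L M ζ v ≤ ((inner ℝ ζ (J L (y + (v : W1q a b n q))) : ℝ) : EReal) :=
  have hmem : J L (y + (v : W1q a b n q)) ∈ infTranslation C L M v :=
    subset_closure (subset_convexHull ℝ _ (mem_sUnion.2 ⟨_, mem_image_of_mem _ hy, J_mem_Jbar hL⟩))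
  iInf₂_le _ hmem

theorem le_scalarization (hζ : ζ ∈ ProperCone.innerDual (C : Set (E d)))
    {M : Set (W1q a b n q)} {v : W1q0 a b n q} {m : ℝ}
    (hL : ∀ y : W1q a b n q, Integrable (fun t => L (t, arc y t)) (μI a b))
    (hm : ∀ y ∈ M, m ≤ inner ℝ ζ (J L (y + (v : W1q a b n q)))) :
    (m : EReal) ≤ scalarization C L M ζ v := by
  refine le_iInf₂ fun z hz => EReal.coe_le_coe_iff.2 (le_inner_of_mem_infG ?_ hz)
  rintro _ ⟨y, hy, rfl⟩ z hz
  exact (hm y hy).trans (inner_J_le_of_mem_Jbar hζ (hL _) hz)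

theorem IsZetaSolution.inner_J_le {X : Set (W1q a b n q)} {y x : W1q a b n q}
    (hy : IsZetaSolution C L X ζ y) (hx : x ∈ X)
    (hL : Integrable (fun t => L (t, arc x t)) (μI a b)) :
    inner ℝ ζ (J L y) ≤ inner ℝ ζ (J L x) := by
  rw [← EReal.coe_le_coe_iff, hy.2]
  exact iInf₂_le_of_le x hx (iInf₂_le _ (J_mem_Jbar hL))

end Scalarization

/-! ### The first variation -/

section FirstVariation

variable {a b : ℝ} {n d : ℕ} {q : ℝ≥0∞} [Fact (1 ≤ q)] {L : ℝ × E n × E n → E d} {ζ : E d}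

theorem norm_fderiv_Lz_section_le {t : ℝ} (hL : Differentiable ℝ fun w => L (t, w))
    (u : E n × E n) {c : ℝ} (hc : ‖fderiv ℝ (fun w => L (t, w)) u‖ ≤ c) :
    ‖fderiv ℝ (fun w => Lz L ζ (t, w)) u‖ ≤ ‖ζ‖ * c := by
  have h : HasFDerivAt (fun w => Lz L ζ (t, w))
      ((innerSL ℝ ζ).comp (fderiv ℝ (fun w => L (t, w)) u)) u :=
    (innerSL ℝ ζ).hasFDerivAt.comp u (hL u).hasFDerivAt
  rw [h.fderiv]
  refine (ContinuousLinearMap.opNorm_comp_le _ _).trans ?_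
  rw [innerSL_apply_norm]
  gcongr

theorem differentiable_Lz_section (hL : ContDiffOn ℝ 1 L (Icc a b ×ˢ univ)) {t : ℝ}
    (ht : t ∈ Icc a b) : Differentiable ℝ fun w => Lz L ζ (t, w) :=
  (innerSL ℝ ζ).differentiable.comp (differentiable_section hL ht)

theorem firstVariation_eq_fderiv (hL : ContDiffOn ℝ 1 L (Icc a b ×ˢ univ)) (y v : W1q a b n q)
    {t : ℝ} (ht : t ∈ Icc a b) :
    firstVariation L ζ y v t = fderiv ℝ (fun w => Lz L ζ (t, w)) (arc y t) (arc v t) :=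
  (fderiv_section_apply (Lz L ζ) t (arc y t) (arc v t) (differentiable_Lz_section hL ht _)).symm

theorem integral_firstVariation_smul (y v : W1q a b n q) (s : ℝ) :
    ∫ t in Icc a b, firstVariation L ζ y (s • v) t =
      s * ∫ t in Icc a b, firstVariation L ζ y v t := by
  rw [← integral_const_mul]
  refine integral_congr_ae ?_
  filter_upwards [arc_smul s v] with t ht
  have h1 : fn (s • v) t = s • fn v t := congrArg Prod.fst ht
  have h2 : dot (s • v) t = s • dot v t := congrArg Prod.snd ht
  simp only [firstVariation, h1, h2, inner_smul_right]
  ring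

/-- The scalarized functional `ζ · J` is Fréchet differentiable on `W^{1,q}`, its derivative being
the integral of the first variation, which converges. -/
theorem exists_abs_inner_J_sub_le (hab : a < b) (hq1 : 1 < q) (hq : q < ∞)
    (hL : ContDiffOn ℝ 1 L (Icc a b ×ˢ univ)) {K₁ K₂ : ℝ} (hK₂ : 0 ≤ K₂)
    (hg : ∀ t ∈ Icc a b, ∀ u, ‖L (t, u)‖ ≤ K₁ * (‖u‖ + 1) ^ q.toReal)
    (hg' : ∀ t ∈ Icc a b, ∀ u,
      ‖fderiv ℝ (fun w => L (t, w)) u‖ ≤ K₂ * (‖u‖ + 1) ^ (q.toReal - 1)) (ζ : E d)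
    (y : W1q a b n q) :
    (∀ v : W1q a b n q, IntegrableOn (firstVariation L ζ y v) (Icc a b)) ∧
    ∀ ε > 0, ∃ δ > 0, ∀ v : W1q a b n q, ‖v‖ < δ →
      |inner ℝ ζ (J L (y + v)) - inner ℝ ζ (J L y) -
        ∫ t in Icc a b, firstVariation L ζ y v t| ≤ ε * ‖v‖ := by
  have hF : ContinuousOn (Lz L ζ) (Icc a b ×ˢ univ) :=
    (innerSL ℝ ζ).continuous.comp_continuousOn hL.continuousOn
  have hd : ∀ t ∈ Icc a b, Differentiable ℝ fun w => Lz L ζ (t, w) :=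
    fun t ht => differentiable_Lz_section hL ht
  have hK : ∀ t ∈ Icc a b, ∀ u,
      ‖Lz L ζ (t, u)‖ ≤ ‖ζ‖ * K₁ * (‖u‖ + 1) ^ q.toReal := fun t ht u => by
    rw [mul_assoc]
    exact (norm_inner_le_norm ζ _).trans
      (mul_le_mul_of_nonneg_left (hg t ht u) (norm_nonneg ζ))
  have hK' : ∀ t ∈ Icc a b, ∀ u, ‖fderiv ℝ (fun w => Lz L ζ (t, w)) u‖ ≤
      ‖ζ‖ * K₂ * (‖u‖ + 1) ^ (q.toReal - 1) := fun t ht u => by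
    rw [mul_assoc]
    exact norm_fderiv_Lz_section_le (differentiable_section hL ht) u (hg' t ht u)
  have hC : 0 ≤ ‖ζ‖ * K₂ := by positivity
  have hfv (v : W1q a b n q) : firstVariation L ζ y v =ᵐ[μI a b]
      fun t => fderiv ℝ (fun w => Lz L ζ (t, w)) (arc y t) (arc v t) := by
    filter_upwards [ae_restrict_mem measurableSet_Icc] with t ht
    exact firstVariation_eq_fderiv hL y v ht
  have hJ (x : W1q a b n q) : inner ℝ ζ (J L x) = ∫ t in Icc a b, Lz L ζ (t, arc x t) :=
    inner_J (integrable_superposition hab.le hq1 hq hL.continuousOn hg (memLp_arc x))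
  refine ⟨fun v => (integrable_fderiv_section hab.le hq1 hq hF hd hC hK' (memLp_arc y)
    (memLp_arc v)).congr (hfv v).symm, fun ε hε => ?_⟩
  obtain ⟨δ, hδ, h⟩ := exists_abs_integral_remainder_le hab.le hq1 hq hF hK hd hC hK' (memLp_arc y)
    (half_pos hε)
  obtain ⟨δ', hδ', hlt⟩ := ENNReal.lt_iff_exists_nnreal_btwn.1 hδ
  have hδ0 : (0 : ℝ) < δ' := by exact_mod_cast hδ'
  refine ⟨δ' / 2, half_pos hδ0, fun v hv => ?_⟩
  have hle := eLpNorm_arc_le v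
  have hlt' : eLpNorm (arc v) q (μI a b) < δ := by
    refine (hle.trans ?_).trans_lt hlt
    rw [← ENNReal.ofReal_coe_nnreal]
    exact ENNReal.ofReal_le_ofReal (by linarith)
  have e : ∫ t in Icc a b, Lz L ζ (t, arc (y + v) t) =
      ∫ t in Icc a b, Lz L ζ (t, arc y t + arc v t) := by
    refine integral_congr_ae ?_
    filter_upwards [arc_add y v] with t ht
    rw [ht]
  rw [hJ, hJ, integral_congr_ae (hfv v), e]
  refine (h (arc v) (memLp_arc v) hlt').trans ?_
  have h2 : (eLpNorm (arc v) q (μI a b)).toReal ≤ 2 * ‖v‖ :=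
    ENNReal.toReal_le_of_le_ofReal (by positivity) hle
  calc ε / 2 * (eLpNorm (arc v) q (μI a b)).toReal ≤ ε / 2 * (2 * ‖v‖) := by gcongr
    _ = ε * ‖v‖ := by ring

end FirstVariation

/-! ### Minimality and squeezing -/

/-- Fermat's rule for a homogeneous first-order approximation `G` of an increment `D ≥ 0`. -/
theorem eq_zero_of_nonneg_of_approx {V : Type*} [NormedAddCommGroup V] [NormedSpace ℝ V]
    {D G : V → ℝ} (hD : ∀ v, 0 ≤ D v) (hG : ∀ (s : ℝ) v, G (s • v) = s * G v)
    (h : ∀ ε > 0, ∃ δ > 0, ∀ v, ‖v‖ < δ → |D v - G v| ≤ ε * ‖v‖) (v : V) : G v = 0 := by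
  have hnonneg (v : V) : 0 ≤ G v := by
    refine le_of_forall_pos_le_add fun ε hε => ?_
    obtain ⟨δ, hδ, hv⟩ := h (ε / (‖v‖ + 1)) (by positivity)
    have hs : 0 < δ / (‖v‖ + 1) := by positivity
    have hnorm : ‖(δ / (‖v‖ + 1)) • v‖ = δ / (‖v‖ + 1) * ‖v‖ := by
      rw [norm_smul, Real.norm_of_nonneg hs.le]
    have h1 := hv ((δ / (‖v‖ + 1)) • v) (by
      rw [hnorm, div_mul_eq_mul_div, div_lt_iff₀ (by positivity)]
      nlinarith [norm_nonneg v])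
    rw [hG, hnorm] at h1
    have h2 : ε / (‖v‖ + 1) * ‖v‖ ≤ ε := by
      rw [div_mul_eq_mul_div, div_le_iff₀ (by positivity)]
      nlinarith [norm_nonneg v]
    have h3 := (abs_le.1 h1).2
    have h4 := hD ((δ / (‖v‖ + 1)) • v)
    have h5 : 0 ≤ δ / (‖v‖ + 1) * (G v + ε / (‖v‖ + 1) * ‖v‖) := by linarith
    have h6 := nonneg_of_mul_nonneg_right h5 hs
    linarith
  have h1 := hnonneg ((-1 : ℝ) • v)
  rw [hG] at h1
  linarith [hnonneg v]

/-- Squeeze rule: an extended real valued function caught between a constant `m` and a function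
`g` with `g 0 = m` and derivative zero at `0` is differentiable at `0` with derivative zero. -/
theorem ehasFDerivAt_zero_of_squeeze {V : Type*} [NormedAddCommGroup V] [NormedSpace ℝ V]
    {f : V → EReal} {g : V → ℝ} {m : ℝ} (hm : ∀ v, (m : EReal) ≤ f v)
    (hg : ∀ v, f v ≤ (g v : EReal)) (hg0 : g 0 = m)
    (h : ∀ ε > 0, ∃ δ > 0, ∀ v, ‖v‖ < δ → |g v - m| ≤ ε * ‖v‖) :
    EHasFDerivAt f 0 0 := by
  have hfin (v : V) : f v ≠ ⊤ ∧ f v ≠ ⊥ :=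
    ⟨((hg v).trans_lt (EReal.coe_lt_top _)).ne, ((EReal.bot_lt_coe _).trans_le (hm v)).ne'⟩
  have hm' (v : V) : m ≤ (f v).toReal := by
    rw [← EReal.coe_le_coe_iff, EReal.coe_toReal (hfin v).1 (hfin v).2]
    exact hm v
  have hg' (v : V) : (f v).toReal ≤ g v := by
    rw [← EReal.coe_le_coe_iff, EReal.coe_toReal (hfin v).1 (hfin v).2]
    exact hg v
  have hval : (f 0).toReal = m := le_antisymm ((hg' 0).trans_eq hg0) (hm' 0)
  refine ⟨Eventually.of_forall hfin, ?_⟩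
  rw [hasFDerivAt_iff_isLittleO_nhds_zero, Asymptotics.isLittleO_iff]
  intro ε hε
  obtain ⟨δ, hδ, hv⟩ := h ε hε
  filter_upwards [Metric.ball_mem_nhds 0 hδ] with v hvδ
  have h1 := hv v (mem_ball_zero_iff.1 hvδ)
  rw [zero_add, zero_apply, sub_zero, hval, Real.norm_of_nonneg (sub_nonneg.2 (hm' v))]
  exact (sub_le_sub_right (hg' v) _).trans ((le_abs_self _).trans h1)

end SetCalcVar

open SetCalcVar
theorem mainTheorem6 (a b : ℝ) (hab : a < b) (n d : ℕ) (hn : 0 < n) (hd : 1 < d)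
    (q : ℝ≥0∞) [Fact (1 ≤ q)] (hq1 : 1 < q) (hq : q < ∞)
    (C : ProperCone ℝ (E d)) (hC : (C : Set (E d)) ≠ Set.univ)
    (L : ℝ × E n × E n → E d)
    (hL : ContDiffOn ℝ 1 L (Set.Icc a b ×ˢ Set.univ))
    (K₁ K₂ : ℝ)
    (hgrowth : ∀ i : Fin d, ∀ t ∈ Set.Icc a b, ∀ y p : E n,
      |L (t, y, p) i| ≤ K₁ * (‖y‖ ^ q.toReal + ‖p‖ ^ q.toReal + 1))
    (hgrowthDp : ∀ i : Fin d, ∀ t ∈ Set.Icc a b, ∀ y p : E n,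
      ‖Dp (fun x => L x i) (t, y, p)‖ ≤
        K₂ * (‖y‖ ^ (q.toReal - 1) + ‖p‖ ^ (q.toReal - 1) + 1))
    (hgrowthDy : ∀ i : Fin d, ∀ t ∈ Set.Icc a b, ∀ y p : E n,
      ‖Dy (fun x => L x i) (t, y, p)‖ ≤
        K₂ * (‖y‖ ^ (q.toReal - 1) + ‖p‖ ^ (q.toReal - 1) + 1))
    (A B : E n) (M : Set (W1q a b n q))
    (hM : IsInfimizer C L (admissible a b n q A B) M)
    (ζ : E d) (hζ : ζ ∈ ProperCone.innerDual (C : Set (E d))) (hζ0 : ζ ≠ 0)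
    (yζ : W1q a b n q) (hyM : yζ ∈ M)
    (hyζ : IsZetaSolution C L (admissible a b n q A B) ζ yζ) :
    (∃ φ' : W1q0 a b n q →L[ℝ] ℝ,
      EHasFDerivAt (scalarization C L M ζ) φ' 0 ∧
      ∀ v : W1q0 a b n q,
        MeasureTheory.IntegrableOn (firstVariation L ζ yζ v) (Set.Icc a b) ∧
        φ' v = ∫ t in Set.Icc a b, firstVariation L ζ yζ v t) ∧
    IsWeakSolution L (admissible a b n q A B) ζ yζ := by
  have hp1 : 1 < q.toReal := (ENNReal.toReal_lt_toReal ENNReal.one_ne_top hq.ne).2 hq1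
  have hg : ∀ t ∈ Icc a b, ∀ u, ‖L (t, u)‖ ≤ d * (3 * |K₁|) * (‖u‖ + 1) ^ q.toReal :=
    fun t ht => norm_lagrangian_le (by linarith) fun i => hgrowth i t ht
  have hg' : ∀ t ∈ Icc a b, ∀ u, ‖fderiv ℝ (fun w => L (t, w)) u‖ ≤
      d * (6 * |K₂|) * (‖u‖ + 1) ^ (q.toReal - 1) := fun t ht =>
    norm_fderiv_section_le (by linarith) (differentiable_section hL ht)
      (fun i => hgrowthDp i t ht) fun i => hgrowthDy i t ht
  have hLint (y : W1q a b n q) : Integrable (fun t => L (t, arc y t)) (μI a b) :=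
    integrable_superposition hab.le hq1 hq hL.continuousOn hg (memLp_arc y)
  obtain ⟨hint, happrox⟩ :=
    exists_abs_inner_J_sub_le hab hq1 hq hL (by positivity) hg hg' ζ yζ
  have hmin (y : W1q a b n q) (hy : y ∈ M) (v : W1q0 a b n q) :
      inner ℝ ζ (J L yζ) ≤ inner ℝ ζ (J L (y + (v : W1q a b n q))) :=
    hyζ.inner_J_le (add_mem_admissible (hM.1 hy) v) (hLint _)
  have hzero : ∀ v : W1q0 a b n q, ∫ t in Icc a b, firstVariation L ζ yζ v t = 0 := by
    refine eq_zero_of_nonneg_of_approx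
      (D := fun v : W1q0 a b n q =>
        inner ℝ ζ (J L (yζ + (v : W1q a b n q))) - inner ℝ ζ (J L yζ))
      (G := fun v : W1q0 a b n q => ∫ t in Icc a b, firstVariation L ζ yζ v t)
      (fun v => sub_nonneg.2 (hmin yζ hyM v))
      (fun s v => integral_firstVariation_smul yζ (v : W1q a b n q) s) fun ε hε => ?_
    obtain ⟨δ, hδ, h⟩ := happrox ε hε
    exact ⟨δ, hδ, fun v hv => h v hv⟩
  have hderiv : EHasFDerivAt (scalarization C L M ζ) 0 0 := by
    refine ehasFDerivAt_zero_of_squeeze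
      (g := fun v : W1q0 a b n q => inner ℝ ζ (J L (yζ + (v : W1q a b n q))))
      (fun v => le_scalarization hζ hLint fun y hy => hmin y hy v)
      (fun v => scalarization_le hyM v (hLint _)) ?_ fun ε hε => ?_
    · exact congrArg (fun y => inner ℝ ζ (J L y)) (add_zero yζ)
    · obtain ⟨δ, hδ, h⟩ := happrox ε hε
      refine ⟨δ, hδ, fun v hv => ?_⟩
      have h1 := h v hv
      rwa [hzero v, sub_zero] at h1
  exact ⟨⟨0, hderiv, fun v => ⟨hint v, (hzero v).symm⟩⟩, hyζ.1, fun v => ⟨hint v, hzero v⟩⟩
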